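/- Let $\mathcal M=(S,A,P,d_0,L)$ be a labelled Markov decision process with finite state space $S$, finite nonempty action space $A$, transition probabilities $P(\cdot\mid s,a)$, initial distribution $d_0$ and labelling $L:S\to 2^{\mathrm{AP}}$. Let $\mathcal B$ be a limit-deterministic Büchi automaton (for a specification $\varphi$) over the alphabet $2^{\mathrm{AP}}$ with finite state set $Q$, initial state $q_{\mathrm{init}}$, deterministic letter transitions $\delta:Q\times 2^{\mathrm{AP}}\to Q$, finitely many jump ($\varepsilon$-)transitions $J(b)$ at each $b\in Q$, and accepting set $Q^*\subseteq Q$; jumps lead from an initial component into a component that is closed under $\delta$, has no jumps and contains $Q^*$. Consider the product MDP with states $z=(s,b)\in \mathcal Z=S\times Q$, and with the available actions $A\sqcup J(b)$ at $(s,b)$: an action $a\in A$ leads to $(s',\delta(b,L(s')))$ with $s'\sim P(\cdot\mid s,a)$; a jump $e\in J(b)$ leads to $(s,b')$, where $b'$ is the target of $e$. The initial state is $(s_0,\delta(q_{\mathrm{init}},L(s_0)))$ with $s_0\sim d_0$. Let $\Pi$ be the set of stationary (possibly stochastic) policies of the product MDP, and $\Pi_{\det}\subseteq\Pi$ the set of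 deterministic ones. For a trajectory $\tau$ with states $(s_0,b_0),(s_1,b_1),\dots$ let $O(\tau)=\{i : b_i\in Q^*\}$, and write $\tau\models\varphi$ if $b_0,b_1,\dots$ is accepted by $\mathcal B$, i.e. if $|O(\tau)|=\infty$. For $\pi\in\Pi$ and $\gamma\in(0,1)$ let $\mathbb P[\pi\models\varphi]$ be the probability that a trajectory generated by $\pi$ satisfies $\varphi$; let $$V_\pi^\gamma=\mathbb E_{\tau\sim\pi}\Big[\sum_{i\ge 0}\Gamma_i\,\mathbf 1_{\{b_i\in Q^*\}}\Big],\qquad \Gamma_i=\prod_{t<i}\gamma_t,\qquad \gamma_t=\begin{cases}\gamma & b_t\in Q^*,\\ 1& b_t\notin Q^*;\end{cases}$$ and let $O_\pi=\mathbb E_{\tau\sim\pi}\big[|O(\tau)|\,\big|\,\tau\not\models\varphi\big]$, with $O_\pi=0$ if $\mathbb P[\pi\not\models\varphi]=0$. Then: 1. $\mathcal Z$ and $\mathcal A=A\sqcup\bigsqcup_{b}J(b)$ are finite, and $\Pi_{\det}$ is finite. 2. Optimal policies can be chosen deterministic: some $\pi^*\in\Pi_{\det}$ satisfies $\mathbb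 P[\pi^*\models\varphi]=\sup_{\pi\in\Pi}\mathbb P[\pi\models\varphi]$, and for every $\gamma\in(0,1)$ some policy in $\Pi_{\det}$ attains $\sup_{\pi\in\Pi}V_\pi^\gamma$. 3. $m:=\sup_{\pi\in\Pi_{\det}}O_\pi$ is finite and attained, and for every $\gamma\in(0,1)$ and every $\pi_\gamma^*\in\arg\max_{\pi\in\Pi_{\det}}V_\pi^\gamma$, $$\sup_{\pi\in\Pi}\mathbb P[\pi\models\varphi]-\mathbb P[\pi_\gamma^*\models\varphi]\le 2m\log\big(\tfrac1\gamma\big).$$ -/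

import Mathlib

open MeasureTheory ProbabilityTheory Filter
open scoped NNReal ENNReal

noncomputable section

/-! ### Markov decision processes, policies and trajectories -/

/-- A Markov decision process with state space `Z` in which the actions available in state `z`
form the type `Act z`: an initial distribution and a transition function. -/
structure MDP (Z : Type*) (Act : Z → Type*) where
  init : PMF Z
  trans : (z : Z) → Act z → PMF Z

/-- A stationary (Markov, stochastic) policy: a probability distribution on the available
actions for every state. -/
def Policy {Z : Type*} (Act : Z → Type*) : Type _ := (z : Z) → PMF (Act z)

/-- A deterministic policy: an available action for every state. -/
def DetPolicy {Z : Type*} (Act : Z → Type*) : Type _ := (z : Z) → Act z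

/-- A deterministic policy, regarded as the stochastic policy that puts all mass on its action. -/
def DetPolicy.toPolicy {Z : Type*} {Act : Z → Type*} (d : DetPolicy Act) : Policy Act :=
  fun z => PMF.pure (d z)

namespace MDP

variable {Z : Type*} {Act : Z → Type*}

/-- The one-step law of the state under `π`: draw `a ∼ π z`, then `z' ∼ P(· | z, a)`. -/
def step (M : MDP Z Act) (π : Policy Act) (z : Z) : PMF Z := (π z).bind (M.trans z)

variable [MeasurableSpace Z] [DiscreteMeasurableSpace Z]

/-- The transition kernel at time `n`, as a function of the history `z₀, …, zₙ`; it depends on the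
current state `zₙ` only. -/
def stepKernel (M : MDP Z Act) (π : Policy Act) (n : ℕ) :
    Kernel ((i : Finset.Iic n) → (fun _ : ℕ => Z) i) Z where
  toFun h := (M.step π (h ⟨n, Finset.mem_Iic.2 le_rfl⟩)).toMeasure
  measurable' :=
    (Measurable.of_discrete (f := fun z : Z => (M.step π z).toMeasure)).comp
      (measurable_pi_apply (⟨n, Finset.mem_Iic.2 le_rfl⟩ : Finset.Iic n))

instance (M : MDP Z Act) (π : Policy Act) (n : ℕ) : IsMarkovKernel (M.stepKernel π n) :=
  ⟨fun _ => PMF.toMeasure.isProbabilityMeasure _⟩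

/-- The law of the state sequence `z₀, z₁, z₂, …` of a random trajectory generated by following
`π`, with `z₀` drawn from the initial distribution. (The actions are integrated out: satisfaction,
visits and values are functions of the state sequence.) -/
def trajLaw (M : MDP Z Act) (π : Policy Act) : Measure (ℕ → Z) :=
  Kernel.trajMeasure (X := fun _ => Z) M.init.toMeasure (M.stepKernel π)

instance (M : MDP Z Act) (π : Policy Act) : IsProbabilityMeasure (M.trajLaw π) := by
  unfold trajLaw
  infer_instance

end MDP

/-! ### Visits to a set of good states, values and satisfaction probabilities -/

section Visits

variable {Z : Type*}

/-- `O(τ)`, the set of times at which the trajectory `τ` is in a good state. -/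
def visits (G : Set Z) (τ : ℕ → Z) : Set ℕ := {i | τ i ∈ G}

/-- `|O(τ)|`, the number of visits to good states, possibly infinite. -/
def numVisits (G : Set Z) (τ : ℕ → Z) : ℝ≥0∞ := ((visits G τ).encard : ℝ≥0∞)

/-- The trajectories that satisfy the Büchi condition: good states are visited infinitely often. -/
def satSet (G : Set Z) : Set (ℕ → Z) := {τ | ∃ᶠ i in atTop, τ i ∈ G}

open Classical in
/-- The eventual discount `Γ_i = ∏_{t < i} γ_t`, where `γ_t = γ` if the state at time `t` is good
and `γ_t = 1` otherwise. -/
def eventualDiscount (G : Set Z) (γ : ℝ) (τ : ℕ → Z) (i : ℕ) : ℝ :=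
  ∏ t ∈ Finset.range i, if τ t ∈ G then γ else 1

end Visits

namespace MDP

variable {Z : Type*} {Act : Z → Type*} [MeasurableSpace Z] [DiscreteMeasurableSpace Z]

/-- The probability that a trajectory generated by `π` satisfies the Büchi condition. -/
def satProb (M : MDP Z Act) (G : Set Z) (π : Policy Act) : ℝ := (M.trajLaw π).real (satSet G)

open Classical in
/-- The eventually discounted value `V_π^γ = 𝔼 [∑_i Γ_i 1{z_i good}]`. -/
def value (M : MDP Z Act) (G : Set Z) (γ : ℝ) (π : Policy Act) : ℝ≥0∞ :=
  ∫⁻ τ, ∑' i : ℕ, ENNReal.ofReal (eventualDiscount G γ τ i * if τ i ∈ G then 1 else 0)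
    ∂(M.trajLaw π)

/-- `O_π`, the expected number of visits to good states conditionally on the trajectory not
satisfying the Büchi condition (and `0` if almost every trajectory satisfies it). -/
def expVisits (M : MDP Z Act) (G : Set Z) (π : Policy Act) : ℝ≥0∞ :=
  ∫⁻ τ, numVisits G τ ∂((M.trajLaw π)[|(satSet G)ᶜ])

end MDP

/-! ### Labelled MDPs, limit-deterministic Büchi automata and their product -/

/-- An MDP with states `S` and actions `A`, whose states are labelled by sets of atomic
propositions. -/
structure LabelledMDP (S A AP : Type*) where
  init : PMF S
  trans : S → A → PMF S
  label : S → Set AP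

/-- A limit-deterministic Büchi automaton over the alphabet of sets of atomic propositions, with
states `Q` and jump (`ε`-)transitions `J b` at the state `b`. Apart from the jumps, which lead from
the initial component into the component `det`, its transitions are deterministic; the component
`det` is closed under reading letters, has no jumps, and contains all accepting states. -/
structure LDBA (AP Q : Type*) (J : Q → Type*) where
  start : Q
  next : Q → Set AP → Q
  jump : (b : Q) → J b → Q
  accepting : Set Q
  det : Set Q
  accepting_subset : accepting ⊆ det
  next_mem : ∀ b ∈ det, ∀ σ, next b σ ∈ det
  jump_mem : ∀ b e, jump b e ∈ det
  no_jump : ∀ b ∈ det, IsEmpty (J b)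

/-- The actions of the product at the state `z = (s, b)`: the actions of the MDP and the jumps of
the automaton that are available at `b`. -/
abbrev ProductAct (S A : Type*) {Q : Type*} (J : Q → Type*) (z : S × Q) : Type _ := A ⊕ J z.2

/-- The product MDP. An action of the MDP moves `s` to a random `s'` while the automaton reads the
label of `s'`; a jump changes the state of the automaton only. Initially the automaton reads the
label of the initial state of the MDP. -/
def productMDP {S A AP Q : Type*} {J : Q → Type*} (M : LabelledMDP S A AP) (B : LDBA AP Q J) :
    MDP (S × Q) (ProductAct S A J) where
  init := M.init.map fun s => (s, B.next B.start (M.label s))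
  trans z
    | .inl a => (M.trans z.1 a).map fun s' => (s', B.next z.2 (M.label s'))
    | .inr e => PMF.pure (z.1, B.jump z.2 e)

/-- The product states whose automaton component is accepting. -/
def goodStates {AP Q : Type*} {J : Q → Type*} (S : Type*) (B : LDBA AP Q J) : Set (S × Q) :=
  {z | z.2 ∈ B.accepting}

end

/-! ### The transition operator -/

/-! The argument concerns an arbitrary finite MDP with a set `G` of good states; the product enters
only in the final theorem. Along a trajectory, each visit to `G` pays the current discount `x` and
lowers it to `γ * x`, so `(1 - γ)` times the sum of payments telescopes to `1` minus the remaining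
discount. This is `1` on satisfying trajectories and at most `1` on all of them; on the others it is
also at most `(1 - γ)` times the number of visits. Integrating gives `ℙ[sat] ≤ (1 - γ) V ≤ ℙ[sat] +
(1 - γ) 𝔼[|O|; unsat]` (`measure_satSet_le_value`, `value_le_measure_satSet_add`). Comparing a
value-optimal policy with a satisfaction-optimal one bounds the gap by `(1 - γ) m ≤ m log (1/γ)`.

Two facts remain. Finiteness of `𝔼[|O|; unsat]` (`setLIntegral_numVisits_ne_top`): let `w z` be the
expectation of `2 ^ (-visits)` from `z`. Where `w z = 0` the Büchi condition holds almost surely, so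
unsatisfying trajectories stay where `w` is bounded below, while the expected sum of `w` over visits
is at most `1`.

Deterministic optimality: the weight is `1` off `G`, so an action greedy for the value may postpone
its reward forever. An extra uniform discount `c < 1` makes greedy policies optimal. As `c → 1`, one
of the finitely many deterministic policies is optimal for `c` arbitrarily close to `1`, and the
inequality passes to the limit. The same pigeonhole with `γ → 1` turns value optimality into
satisfaction optimality. -/

section TransOp

variable {Z : Type*}

/-- The weighted transition operator `f ↦ g · P f` of a Markov chain. -/
noncomputable def transOp (p : Z → PMF Z) (g f : Z → ℝ≥0∞) : Z → ℝ≥0∞ :=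
  fun z => g z * ∑' z', p z z' * f z'

theorem transOp_mono (p : Z → PMF Z) (g : Z → ℝ≥0∞) : Monotone (transOp p g) := by
  intro f f' h z
  unfold transOp
  gcongr with z'
  exact h z'

theorem transOp_add (p : Z → PMF Z) (g f f' : Z → ℝ≥0∞) :
    transOp p g (f + f') = transOp p g f + transOp p g f' := by
  ext z
  simp only [transOp, Pi.add_apply, mul_add, ENNReal.tsum_add]

theorem transOp_const_mul (p : Z → PMF Z) (g f : Z → ℝ≥0∞) (c : ℝ≥0∞) :
    transOp p g (fun z => c * f z) = fun z => c * transOp p g f z := by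
  ext z
  simp only [transOp, mul_left_comm _ c, ENNReal.tsum_mul_left]

theorem transOp_finset_sum {ι : Type*} (p : Z → PMF Z) (g : Z → ℝ≥0∞) (s : Finset ι)
    (f : ι → Z → ℝ≥0∞) :
    transOp p g (fun z => ∑ i ∈ s, f i z) = fun z => ∑ i ∈ s, transOp p g (f i) z := by
  classical
  induction s using Finset.induction_on with
  | empty => ext z; simp [transOp]
  | insert a s ha ih =>
    simp only [Finset.sum_insert ha]
    rw [show (fun z => f a z + ∑ i ∈ s, f i z) = f a + fun z => ∑ i ∈ s, f i z from rfl,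
      transOp_add, ih]
    rfl

theorem transOp_const_le (p : Z → PMF Z) {g : Z → ℝ≥0∞} (hg : ∀ z, g z ≤ 1) (c : ℝ≥0∞) (z : Z) :
    transOp p g (fun _ => c) z ≤ c := by
  simp only [transOp, ENNReal.tsum_mul_right, PMF.tsum_coe, one_mul]
  exact mul_le_of_le_one_left' (hg z)

end TransOp

/-! ### The Markov property of trajectories -/

namespace MDP

variable {Z : Type*} {Act : Z → Type*} [MeasurableSpace Z] [DiscreteMeasurableSpace Z]

theorem lintegral_pmf [Countable Z] (p : PMF Z) (f : Z → ℝ≥0∞) :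
    ∫⁻ z, f z ∂p.toMeasure = ∑' z, p z * f z := by
  rw [lintegral_countable']
  refine tsum_congr fun z => ?_
  rw [PMF.toMeasure_apply_singleton _ _ (MeasurableSet.singleton z), mul_comm]

/-- The state at time `0` has the initial distribution. -/
theorem lintegral_trajLaw_zero [Countable Z] (M : MDP Z Act) (π : Policy Act) (f : Z → ℝ≥0∞) :
    ∫⁻ τ, f (τ 0) ∂(M.trajLaw π) = ∑' z, M.init z * f z := by
  have hf : Measurable f := Measurable.of_discrete
  have hm : Measurable fun τ : ℕ → Z => f (τ 0) := hf.comp (measurable_pi_apply 0)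
  have h : ∀ x₀ : (i : Finset.Iic 0) → (fun _ : ℕ => Z) i,
      ∫⁻ τ : ℕ → Z, f (τ 0) ∂(Kernel.traj (X := fun _ => Z) (M.stepKernel π) 0 x₀) =
        f (x₀ ⟨0, Finset.mem_Iic.2 le_rfl⟩) := by
    intro x₀
    have hx := Kernel.traj_map_frestrictLe_apply (X := fun _ => Z) (κ := M.stepKernel π) 0 0 x₀
    rw [Kernel.partialTraj_self, Kernel.id_apply] at hx
    have hy : Measurable fun y : (i : Finset.Iic 0) → (fun _ : ℕ => Z) i =>
        f (y ⟨0, Finset.mem_Iic.2 le_rfl⟩) := hf.comp (measurable_pi_apply _)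
    have := lintegral_map (μ := Kernel.traj (X := fun _ => Z) (M.stepKernel π) 0 x₀) hy
      (Preorder.measurable_frestrictLe (X := fun _ => Z) 0)
    rw [hx, lintegral_dirac' _ hy] at this
    exact this.symm
  rw [← lintegral_pmf, trajLaw, Kernel.trajMeasure,
    Measure.lintegral_bind (Kernel.aemeasurable _) hm.aemeasurable,
    lintegral_map (Measurable.lintegral_kernel hm) (MeasurableEquiv.measurable _)]
  exact lintegral_congr fun z => h _

/-- Conditionally on the past, the next state is distributed according to `M.step π`. -/
theorem lintegral_trajLaw_succ [Finite Z] (M : MDP Z Act) (π : Policy Act) (n : ℕ)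
    {Φ : (ℕ → Z) → ℝ≥0∞} (hΦ : DependsOn Φ (Finset.Iic n : Set ℕ)) (f : Z → ℝ≥0∞) :
    ∫⁻ τ, Φ τ * f (τ (n + 1)) ∂(M.trajLaw π) =
      ∫⁻ τ, Φ τ * ∑' z', M.step π (τ n) z' * f z' ∂(M.trajLaw π) := by
  by_cases hZ : IsEmpty Z
  · have : IsEmpty (ℕ → Z) := ⟨fun τ => hZ.elim (τ 0)⟩
    simp [lintegral_of_isEmpty]
  rw [not_isEmpty_iff] at hZ
  obtain ⟨φ, rfl⟩ := (dependsOn_iff_exists_comp).1 hΦ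
  have hφ : Measurable φ := Measurable.of_discrete
  have hf : Measurable f := Measurable.of_discrete
  have key := Kernel.map_frestrictLe_trajMeasure_compProd_eq_map_trajMeasure
    (X := fun _ => Z) (μ₀ := M.init.toMeasure) (κ := M.stepKernel π) (a := n)
  have h1 := congrArg (fun μ => ∫⁻ x, φ x.1 * f x.2 ∂μ) key
  rw [Measure.lintegral_compProd (by fun_prop), lintegral_map (Measurable.of_discrete)
    (by fun_prop), lintegral_map (by fun_prop) (by fun_prop)] at h1
  refine h1.symm.trans (lintegral_congr fun τ => ?_)
  refine (lintegral_const_mul (μ := (M.step π (τ n)).toMeasure)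
    (φ (Preorder.frestrictLe (π := fun _ => Z) n τ)) hf).trans ?_
  rw [← lintegral_pmf]
  rfl

/-- The factor `Φ` of the past makes the induction go through: `g (τ i)` is absorbed into `Φ` before
the block is shifted by one step. -/
theorem lintegral_trajLaw_iterate [Finite Z] (M : MDP Z Act) (π : Policy Act) (g f : Z → ℝ≥0∞)
    (n : ℕ) : ∀ (i : ℕ) {Φ : (ℕ → Z) → ℝ≥0∞}, DependsOn Φ (Finset.Iic i : Set ℕ) →
    ∫⁻ τ, Φ τ * ((∏ t ∈ Finset.range n, g (τ (i + t))) * f (τ (i + n))) ∂(M.trajLaw π) =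
      ∫⁻ τ, Φ τ * (transOp (M.step π) g)^[n] f (τ i) ∂(M.trajLaw π) := by
  induction n with
  | zero => intro i Φ _; simp
  | succ n ih =>
    intro i Φ hΦ
    have hΦ' : DependsOn (fun τ => Φ τ * g (τ i)) (Finset.Iic (i + 1) : Set ℕ) := by
      intro x y h
      have h1 : Φ x = Φ y := hΦ fun j hj => h j (by simp at hj ⊢; omega)
      have h2 : x i = y i := h i (by simp)
      simp only [h1, h2]
    have hΦ'' : DependsOn (fun τ => Φ τ * g (τ i)) (Finset.Iic i : Set ℕ) := by
      intro x y h
      have h2 : x i = y i := h i (by simp)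
      simp only [hΦ h, h2]
    calc _ = ∫⁻ τ, (Φ τ * g (τ i)) * ((∏ t ∈ Finset.range n, g (τ (i + 1 + t))) *
            f (τ (i + 1 + n))) ∂(M.trajLaw π) := by
          refine lintegral_congr fun τ => ?_
          rw [Finset.prod_range_succ', add_zero]
          simp only [add_assoc, add_comm 1]
          ring
      _ = _ := by
          rw [ih (i + 1) hΦ', lintegral_trajLaw_succ M π i hΦ'']
          refine lintegral_congr fun τ => ?_
          rw [Function.iterate_succ_apply', mul_assoc]
          rfl

end MDP

/-! ### Deterministic policies that are optimal for total weighted rewards -/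

section TotalReward

variable {Z : Type*}

/-- The partial sums of a discounted total reward satisfy the Bellman recursion. -/
theorem discounted_sum_succ (p : Z → PMF Z) (g r : Z → ℝ≥0∞) (c : ℝ≥0∞) (n : ℕ) (z : Z) :
    ∑ i ∈ Finset.range (n + 1), c ^ i * (transOp p g)^[i] r z =
      r z + c * transOp p g (fun z => ∑ i ∈ Finset.range n, c ^ i * (transOp p g)^[i] r z) z := by
  rw [transOp_finset_sum, Finset.sum_range_succ', add_comm, Finset.mul_sum]
  congr 1
  · simp
  · refine Finset.sum_congr rfl fun i _ => ?_
    rw [transOp_const_mul, Function.iterate_succ_apply', pow_succ']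
    ring

end TotalReward

namespace MDP

variable {Z : Type*} {Act : Z → Type*}

theorem step_toPolicy (M : MDP Z Act) (d : DetPolicy Act) (z : Z) :
    M.step d.toPolicy z = M.trans z (d z) := by
  simp [step, DetPolicy.toPolicy]

/-- A randomized step is an average over actions, hence no better than the best one. -/
theorem transOp_step_le_iSup (M : MDP Z Act) (π : Policy Act) (g v : Z → ℝ≥0∞) (z : Z) :
    transOp (M.step π) g v z ≤ ⨆ a, g z * ∑' z', M.trans z a z' * v z' := by
  calc transOp (M.step π) g v z
      = ∑' a, π z a * (g z * ∑' z', M.trans z a z' * v z') := by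
        simp only [transOp, step, PMF.bind_apply, ← ENNReal.tsum_mul_right,
          ← ENNReal.tsum_mul_left]
        rw [ENNReal.tsum_comm]
        refine tsum_congr fun a => tsum_congr fun z' => ?_
        ring
    _ ≤ ∑' a, π z a * ⨆ a, g z * ∑' z', M.trans z a z' * v z' := by
        gcongr with a
        exact le_iSup (fun a => g z * ∑' z', M.trans z a z' * v z') a
    _ = _ := by rw [ENNReal.tsum_mul_right, PMF.tsum_coe, one_mul]

/-- The Bellman optimality operator. -/
noncomputable def bellman (M : MDP Z Act) (g r : Z → ℝ≥0∞) (c : ℝ≥0∞) :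
    (Z → ℝ≥0∞) →o (Z → ℝ≥0∞) where
  toFun v z := r z + c * ⨆ a, g z * ∑' z', M.trans z a z' * v z'
  monotone' := by
    intro v v' h z
    dsimp only
    gcongr with a z'
    exact h z'

/-- With a uniform discount, a policy that is greedy for the least fixed point of the Bellman
operator is optimal. -/
theorem exists_detPolicy_discounted [∀ z, Finite (Act z)] [∀ z, Nonempty (Act z)]
    (M : MDP Z Act) {g r : Z → ℝ≥0∞} (hg : ∀ z, g z ≤ 1) (hr : ∀ z, r z ≤ 1) {c : ℝ≥0∞}
    (hc : c < 1) :
    ∃ d : DetPolicy Act, ∀ (π : Policy Act) (z : Z),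
      ∑' i, c ^ i * (transOp (M.step π) g)^[i] r z ≤
        ∑' i, c ^ i * (transOp (M.step d.toPolicy) g)^[i] r z := by
  set v := OrderHom.lfp (M.bellman g r c)
  have hfix : ∀ z, v z = r z + c * ⨆ a, g z * ∑' z', M.trans z a z' * v z' := fun z =>
    (congrFun (OrderHom.map_lfp (M.bellman g r c)) z).symm
  have hc0 : 1 - c ≠ 0 := (tsub_pos_of_lt hc).ne'
  have hct : 1 - c ≠ ∞ := ENNReal.sub_ne_top ENNReal.one_ne_top
  have hbound : ∀ z, v z ≤ (1 - c)⁻¹ := by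
    refine OrderHom.lfp_le (M.bellman g r c) (a := fun _ => (1 - c)⁻¹) fun z => ?_
    -- The action `a` is available only at `z`, so the chain used here has the law `M.trans z a` at
    -- every state; only its value at `z` matters.
    have h1 : ⨆ a, g z * ∑' z', M.trans z a z' * (1 - c)⁻¹ ≤ (1 - c)⁻¹ := iSup_le fun a =>
      transOp_const_le (fun z' => M.trans z a) hg (1 - c)⁻¹ z
    calc M.bellman g r c (fun _ => (1 - c)⁻¹) z ≤ 1 + c * (1 - c)⁻¹ := by
          exact add_le_add (hr z) (mul_le_mul_right h1 c)
      _ = (1 - c) * (1 - c)⁻¹ + c * (1 - c)⁻¹ := by rw [ENNReal.mul_inv_cancel hc0 hct]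
      _ = (1 - c)⁻¹ := by rw [← add_mul, tsub_add_cancel_of_le hc.le, one_mul]
  have hgreedy : ∃ d : DetPolicy Act, ∀ z, g z * ∑' z', M.trans z (d z) z' * v z' =
      ⨆ a, g z * ∑' z', M.trans z a z' * v z' := Classical.axiom_of_choice fun z =>
    exists_eq_ciSup_of_finite (f := fun a : Act z => g z * ∑' z', M.trans z a z' * v z')
  obtain ⟨d, hd⟩ := hgreedy
  refine ⟨d, fun π z => ?_⟩
  -- Any policy collects at most `v` in finitely many steps, by induction through the Bellman
  -- equation.
  have hupper : ∀ n z, ∑ i ∈ Finset.range n, c ^ i * (transOp (M.step π) g)^[i] r z ≤ v z := by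
    intro n
    induction n with
    | zero => simp
    | succ n ih =>
      intro z
      rw [discounted_sum_succ, hfix z]
      gcongr
      exact (transOp_mono _ _ ih z).trans (M.transOp_step_le_iSup π g v z)
  -- The greedy policy loses nothing at each step, so after `n` steps it misses only the discounted
  -- remainder of `v`, bounded through `hbound`.
  have hlower : ∀ n z, v z ≤
      ∑ i ∈ Finset.range n, c ^ i * (transOp (M.step d.toPolicy) g)^[i] r z +
        c ^ n * (1 - c)⁻¹ := by
    intro n
    induction n with
    | zero => simpa using hbound
    | succ n ih =>
      intro z
      rw [discounted_sum_succ, hfix z, ← hd z, add_assoc, pow_succ', mul_assoc, ← mul_add]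
      gcongr
      calc g z * ∑' z', M.trans z (d z) z' * v z' = transOp (M.step d.toPolicy) g v z := by
            simp only [transOp, step_toPolicy]
        _ ≤ _ := transOp_mono _ _ ih z
        _ ≤ _ := by
            rw [show (fun z => ∑ i ∈ Finset.range n, c ^ i *
              (transOp (M.step d.toPolicy) g)^[i] r z + c ^ n * (1 - c)⁻¹) =
              (fun z => ∑ i ∈ Finset.range n, c ^ i *
              (transOp (M.step d.toPolicy) g)^[i] r z) +
              fun _ => c ^ n * (1 - c)⁻¹ from rfl, transOp_add]
            exact add_le_add le_rfl (transOp_const_le _ hg _ z)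
  refine (ENNReal.tsum_le_of_sum_range_le fun n => hupper n z).trans ?_
  have hlim : Tendsto (fun n : ℕ => ∑' i, c ^ i *
      (transOp (M.step d.toPolicy) g)^[i] r z + c ^ n * (1 - c)⁻¹) atTop
      (nhds (∑' i, c ^ i * (transOp (M.step d.toPolicy) g)^[i] r z + 0 * (1 - c)⁻¹)) :=
    tendsto_const_nhds.add (ENNReal.Tendsto.mul_const
      (ENNReal.tendsto_pow_atTop_nhds_zero_of_lt_one hc) (Or.inr (ENNReal.inv_ne_top.2 hc0)))
  rw [zero_mul, add_zero] at hlim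
  exact ge_of_tendsto' hlim fun n => (hlower n z).trans (by gcongr; exact ENNReal.sum_le_tsum _)

/-- Pigeonhole for filters: finitely many alternatives that each eventually fail would eventually
fail together. -/
theorem exists_frequently_of_finite {α ι : Type*} [Finite ι] {l : Filter α} [l.NeBot]
    {p : ι → α → Prop} (h : ∀ᶠ x in l, ∃ i, p i x) : ∃ i, ∃ᶠ x in l, p i x := by
  by_contra! hn
  obtain ⟨x, ⟨i, hi⟩, hx⟩ := (h.and (eventually_all.2 hn)).exists
  exact hx i hi

instance [Finite Z] [∀ z, Finite (Act z)] : Finite (DetPolicy Act) :=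
  inferInstanceAs (Finite ((z : Z) → Act z))

/-- Some deterministic policy maximizes the total weighted reward from every state. -/
theorem exists_detPolicy_total [Finite Z] [∀ z, Finite (Act z)] [∀ z, Nonempty (Act z)]
    (M : MDP Z Act) {g r : Z → ℝ≥0∞} (hg : ∀ z, g z ≤ 1) (hr : ∀ z, r z ≤ 1) :
    ∃ d : DetPolicy Act, ∀ (π : Policy Act) (z : Z),
      ∑' i, (transOp (M.step π) g)^[i] r z ≤
        ∑' i, (transOp (M.step d.toPolicy) g)^[i] r z := by
  have : (nhdsWithin (1 : ℝ≥0∞) (Set.Iio 1)).NeBot := nhdsLT_neBot_of_exists_lt ⟨0, one_pos⟩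
  obtain ⟨d, hd⟩ := exists_frequently_of_finite (l := nhdsWithin (1 : ℝ≥0∞) (Set.Iio 1))
    (eventually_nhdsWithin_of_forall fun c (hc : c < 1) => M.exists_detPolicy_discounted hg hr hc)
  refine ⟨d, fun π z => ENNReal.tsum_le_of_sum_range_le fun n => ?_⟩
  have hcont : Tendsto (fun c : ℝ≥0∞ => ∑ i ∈ Finset.range n,
      c ^ i * (transOp (M.step π) g)^[i] r z) (nhdsWithin 1 (Set.Iio 1))
      (nhds (∑ i ∈ Finset.range n, 1 ^ i * (transOp (M.step π) g)^[i] r z)) := by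
    refine tendsto_finsetSum _ fun i _ => ?_
    refine ENNReal.Tendsto.mul_const ?_ (Or.inl (by simp))
    exact ((ENNReal.continuous_pow i).tendsto 1).mono_left nhdsWithin_le_nhds
  simp only [one_pow, one_mul] at hcont
  refine le_of_tendsto_of_frequently hcont ((hd.and_eventually self_mem_nhdsWithin).mono ?_)
  rintro c ⟨hc, hc1⟩
  -- Dropping the powers of `c` only increases the total of `d`, so the bound is uniform in `c`.
  refine (ENNReal.sum_le_tsum _).trans ((hc π z).trans ?_)
  gcongr with i
  exact mul_le_of_le_one_left' (pow_le_one' (le_of_lt hc1) i)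

end MDP

/-! ### Weighted visits along a trajectory -/

section Weights

variable {Z : Type*} (G : Set Z)

open Classical in
/-- The weight `c` at good states and `1` elsewhere. -/
noncomputable def visitWeight (c : ℝ≥0∞) (z : Z) : ℝ≥0∞ := if z ∈ G then c else 1

open Classical in
/-- The reward `1` at good states and `0` elsewhere. -/
noncomputable def visitReward (z : Z) : ℝ≥0∞ := if z ∈ G then 1 else 0

/-- The eventually discounted number of visits with discount factor `c`. -/
noncomputable def discountedVisits (c : ℝ≥0∞) (τ : ℕ → Z) : ℝ≥0∞ :=
  ∑' i, (∏ t ∈ Finset.range i, visitWeight G c (τ t)) * visitReward G (τ i)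

variable {G}

theorem visitWeight_le_one {c : ℝ≥0∞} (hc : c ≤ 1) (z : Z) : visitWeight G c z ≤ 1 := by
  unfold visitWeight
  split_ifs <;> simp [hc]

theorem le_visitWeight {c : ℝ≥0∞} (hc : c ≤ 1) (z : Z) : c ≤ visitWeight G c z := by
  unfold visitWeight
  split_ifs <;> simp [hc]

theorem visitReward_le_one (z : Z) : visitReward G z ≤ 1 := by
  unfold visitReward
  split_ifs <;> simp

theorem numVisits_eq_tsum (τ : ℕ → Z) : numVisits G τ = ∑' i, visitReward G (τ i) := by
  rw [numVisits, ← ENNReal.tsum_set_one, tsum_subtype (visits G τ) (fun _ => (1 : ℝ≥0∞))]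
  refine tsum_congr fun i => ?_
  simp only [visitReward, visits, Set.indicator, Set.mem_ofPred_eq]
  congr

theorem discountedVisits_le_numVisits {c : ℝ≥0∞} (hc : c ≤ 1) (τ : ℕ → Z) :
    discountedVisits G c τ ≤ numVisits G τ := by
  rw [numVisits_eq_tsum]
  exact ENNReal.tsum_le_tsum fun i => mul_le_of_le_one_left'
    (Finset.prod_le_one' fun t _ => visitWeight_le_one hc _)

/-- Telescoping: a visit moves the share `e` of the remaining product into the sum and leaves the
share `c`. -/
theorem sum_discountedVisits_add_prod {c e : ℝ≥0∞} (h : c + e = 1) (τ : ℕ → Z) (n : ℕ) :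
    e * ∑ i ∈ Finset.range n, (∏ t ∈ Finset.range i, visitWeight G c (τ t)) *
      visitReward G (τ i) + ∏ t ∈ Finset.range n, visitWeight G c (τ t) = 1 := by
  induction n with
  | zero => simp
  | succ n ih =>
    rw [Finset.sum_range_succ, Finset.prod_range_succ, ← ih, mul_add, add_assoc]
    congr 1
    unfold visitReward
    set x := ∏ t ∈ Finset.range n, visitWeight G c (τ t)
    by_cases hz : τ n ∈ G
    · simp only [visitWeight, hz, if_true, mul_one]
      calc e * x + x * c = (c + e) * x := by ring
        _ = x := by rw [h, one_mul]
    · simp [visitWeight, hz]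

theorem mul_discountedVisits_le_one {c e : ℝ≥0∞} (h : c + e = 1) (τ : ℕ → Z) :
    e * discountedVisits G c τ ≤ 1 := by
  rw [discountedVisits, ← ENNReal.tsum_mul_left]
  refine ENNReal.tsum_le_of_sum_range_le fun n => ?_
  rw [← Finset.mul_sum, ← sum_discountedVisits_add_prod h τ n]
  exact le_self_add

theorem prod_visitWeight_antitone {c : ℝ≥0∞} (hc : c ≤ 1) (τ : ℕ → Z) :
    Antitone fun n => ∏ t ∈ Finset.range n, visitWeight G c (τ t) :=
  antitone_nat_of_succ_le fun n => by
    rw [Finset.prod_range_succ]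
    exact mul_le_of_le_one_right' (visitWeight_le_one hc _)

/-- Infinitely many visits drive the remaining product in the telescoped identity to `0`. -/
theorem one_le_mul_discountedVisits {c e : ℝ≥0∞} (h : c + e = 1) (hc : c < 1) {τ : ℕ → Z}
    (hτ : τ ∈ satSet G) : 1 ≤ e * discountedVisits G c τ := by
  have hsmall : ∀ k : ℕ, ∃ n, ∏ t ∈ Finset.range n, visitWeight G c (τ t) ≤ c ^ k := by
    intro k
    induction k with
    | zero => exact ⟨0, by simp⟩
    | succ k ih =>
      obtain ⟨n, hn⟩ := ih
      obtain ⟨i, hi, hG⟩ := frequently_atTop.1 hτ n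
      refine ⟨i + 1, ?_⟩
      rw [Finset.prod_range_succ, pow_succ]
      gcongr
      · exact (prod_visitWeight_antitone hc.le τ hi).trans hn
      · simp [visitWeight, hG]
  have hlim : Tendsto (fun k : ℕ => e * discountedVisits G c τ + c ^ k) atTop
      (nhds (e * discountedVisits G c τ + 0)) :=
    tendsto_const_nhds.add (ENNReal.tendsto_pow_atTop_nhds_zero_of_lt_one hc)
  rw [add_zero] at hlim
  refine ge_of_tendsto' hlim fun k => ?_
  obtain ⟨n, hn⟩ := hsmall k
  rw [← sum_discountedVisits_add_prod h τ n]
  gcongr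
  exact ENNReal.sum_le_tsum _

/-- Weighting each visit by `1/2` to the number of visits from then on, the total is at most `1`. -/
theorem sum_visitReward_mul_prod_le_one (τ : ℕ → Z) (n : ℕ) :
    ∑ i ∈ Finset.range n, visitReward G (τ i) *
      ∏ t ∈ Finset.range (n - i), visitWeight G 2⁻¹ (τ (i + t)) ≤ 1 := by
  induction n with
  | zero => simp
  | succ n ih =>
    -- Time `n` multiplies all earlier weights by its own. A visit adds `1` and then halves, which
    -- preserves the bound `1`: counted from the last visit, the terms are `1/2, 1/4, …`.
    have hrec : ∑ i ∈ Finset.range (n + 1), visitReward G (τ i) *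
        ∏ t ∈ Finset.range (n + 1 - i), visitWeight G 2⁻¹ (τ (i + t)) =
        (∑ i ∈ Finset.range n, visitReward G (τ i) *
          ∏ t ∈ Finset.range (n - i), visitWeight G 2⁻¹ (τ (i + t)) + visitReward G (τ n)) *
          visitWeight G 2⁻¹ (τ n) := by
      rw [Finset.sum_range_succ, add_mul, Finset.sum_mul]
      congr 1
      · refine Finset.sum_congr rfl fun i hi => ?_
        have hi' : i < n := Finset.mem_range.1 hi
        rw [Nat.succ_sub hi'.le, Finset.prod_range_succ, Nat.add_sub_cancel' hi'.le, mul_assoc]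
      · simp
    rw [hrec]
    by_cases hz : τ n ∈ G
    · simp only [visitReward, visitWeight, hz, if_true] at ih ⊢
      calc _ ≤ ((1 : ℝ≥0∞) + 1) * 2⁻¹ := by gcongr
        _ = 1 := by rw [one_add_one_eq_two]; exact ENNReal.mul_inv_cancel (by simp) (by simp)
    · simpa [visitReward, visitWeight, hz] using ih

theorem iInf_prod_visitWeight_ne_zero {c : ℝ≥0∞} (hc : c ≤ 1) (hc0 : c ≠ 0) {τ : ℕ → Z}
    (hτ : τ ∉ satSet G) (i : ℕ) :
    ⨅ n, ∏ t ∈ Finset.range n, visitWeight G c (τ (i + t)) ≠ 0 := by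
  obtain ⟨K, hK⟩ := eventually_atTop.1 (not_frequently.1 hτ)
  -- No visit occurs from time `K` on, so at most `K` factors differ from `1`.
  have hle : ∀ n, c ^ K ≤ ∏ t ∈ Finset.range n, visitWeight G c (τ (i + t)) := by
    intro n
    have h1 : c ^ min n K ≤ ∏ t ∈ Finset.range n, visitWeight G c (τ (i + t)) := by
      induction n with
      | zero => simp
      | succ n ih =>
        rw [Finset.prod_range_succ]
        rcases lt_or_ge n K with hn | hn
        · rw [min_eq_left hn.le] at ih
          rw [min_eq_left hn, pow_succ]
          exact mul_le_mul' ih (le_visitWeight hc _)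
        · rw [min_eq_right hn] at ih
          rw [min_eq_right (by omega)]
          simpa [visitWeight, hK (i + n) (by omega)] using ih
    exact (pow_le_pow_right_of_le_one' hc (min_le_right n K)).trans h1
  exact ((ENNReal.pow_pos (pos_iff_ne_zero.2 hc0) K).trans_le (le_iInf hle)).ne'

theorem measurable_visitReward [MeasurableSpace Z] [DiscreteMeasurableSpace Z] (i : ℕ) :
    Measurable fun τ : ℕ → Z => visitReward G (τ i) :=
  (Measurable.of_discrete (f := visitReward G)).comp (measurable_pi_apply i)

theorem measurable_prod_visitWeight [MeasurableSpace Z] [DiscreteMeasurableSpace Z] (c : ℝ≥0∞)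
    (i n : ℕ) :
    Measurable fun τ : ℕ → Z => ∏ t ∈ Finset.range n, visitWeight G c (τ (i + t)) :=
  Finset.measurable_prod _ fun t _ =>
    (Measurable.of_discrete (f := visitWeight G c)).comp (measurable_pi_apply (i + t))

theorem measurableSet_satSet [MeasurableSpace Z] [DiscreteMeasurableSpace Z] :
    MeasurableSet (satSet G) := by
  have : satSet G = limsup (fun i => {τ : ℕ → Z | τ i ∈ G}) atTop := by
    ext τ
    simp [satSet, Filter.mem_limsup_iff_frequently_mem]
  rw [this]
  exact MeasurableSet.measurableSet_limsup fun i =>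
    measurable_pi_apply i (MeasurableSet.of_discrete (s := G))

end Weights

/-! ### Values and finiteness of the number of visits -/

namespace MDP

variable {Z : Type*} {Act : Z → Type*} [MeasurableSpace Z] [DiscreteMeasurableSpace Z] {G : Set Z}

theorem value_eq_lintegral (M : MDP Z Act) {γ : ℝ} (hγ : 0 ≤ γ) (π : Policy Act) :
    M.value G γ π = ∫⁻ τ, discountedVisits G (ENNReal.ofReal γ) τ ∂(M.trajLaw π) := by
  refine lintegral_congr fun τ => tsum_congr fun i => ?_
  have h0 : ∀ z, 0 ≤ (open Classical in if z ∈ G then γ else 1) := fun z => by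
    split_ifs <;> simp [hγ]
  rw [eventualDiscount, ENNReal.ofReal_mul (Finset.prod_nonneg fun t _ => h0 _),
    ENNReal.ofReal_prod_of_nonneg fun t _ => h0 _]
  congr 1
  · refine Finset.prod_congr rfl fun t _ => ?_
    unfold visitWeight
    split_ifs <;> simp
  · unfold visitReward
    split_ifs <;> simp

/-- Puts the value in the form to which `exists_detPolicy_total` applies, for all initial states at
once. -/
theorem value_eq_tsum [Finite Z] (M : MDP Z Act) {γ : ℝ} (hγ : 0 ≤ γ) (π : Policy Act) :
    M.value G γ π = ∑' z, M.init z *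
      ∑' i, (transOp (M.step π) (visitWeight G (ENNReal.ofReal γ)))^[i] (visitReward G) z := by
  rw [value_eq_lintegral M hγ, ← lintegral_trajLaw_zero M π]
  unfold discountedVisits
  rw [lintegral_tsum, lintegral_tsum]
  · refine tsum_congr fun i => ?_
    have := M.lintegral_trajLaw_iterate π (visitWeight G (ENNReal.ofReal γ)) (visitReward G) i 0
      (Φ := fun _ => 1) (fun _ _ _ => rfl)
    simpa using this
  · exact fun i => ((Measurable.of_discrete (f := (transOp (M.step π) _)^[i] _)).comp
      (measurable_pi_apply 0)).aemeasurable
  · intro i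
    have := measurable_prod_visitWeight (G := G) (ENNReal.ofReal γ) 0 i
    simp only [zero_add] at this
    exact (this.mul (measurable_visitReward i)).aemeasurable

theorem exists_detPolicy_value [Finite Z] [∀ z, Finite (Act z)] [∀ z, Nonempty (Act z)]
    (M : MDP Z Act) (G : Set Z) {γ : ℝ} (hγ : γ ∈ Set.Ioo (0 : ℝ) 1) :
    ∃ d : DetPolicy Act, ∀ π : Policy Act, M.value G γ π ≤ M.value G γ d.toPolicy := by
  obtain ⟨d, hd⟩ := M.exists_detPolicy_total
    (visitWeight_le_one (G := G) (ENNReal.ofReal_le_one.2 hγ.2.le)) (visitReward_le_one (G := G))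
  refine ⟨d, fun π => ?_⟩
  rw [value_eq_tsum M hγ.1.le, value_eq_tsum M hγ.1.le]
  exact ENNReal.tsum_le_tsum fun z => mul_le_mul_right (hd π z) _

open Classical in
/-- Under a stationary policy on a finite state space, the expected number of visits on the
trajectories with finitely many visits is finite. -/
theorem setLIntegral_numVisits_ne_top [Finite Z] (M : MDP Z Act) (G : Set Z) (π : Policy Act) :
    ∫⁻ τ in (satSet G)ᶜ, numVisits G τ ∂(M.trajLaw π) ≠ ∞ := by
  set μ := M.trajLaw π
  set D := transOp (M.step π) (visitWeight G 2⁻¹)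
  -- `D^[n] 1 z` is the expectation of `2 ^ (-visits)` over the first `n` times from `z`; it
  -- decreases to `w z`.
  set w : Z → ℝ≥0∞ := fun z => ⨅ n, D^[n] (fun _ => 1) z
  have hhalf : (2⁻¹ : ℝ≥0∞) ≤ 1 := by simp
  have hmeas : ∀ f : Z → ℝ≥0∞, ∀ i, Measurable fun τ : ℕ → Z => f (τ i) := fun f i =>
    (Measurable.of_discrete (f := f)).comp (measurable_pi_apply i)
  have hdep : ∀ (f : Z → ℝ≥0∞) (i : ℕ),
      DependsOn (fun τ : ℕ → Z => f (τ i)) (Finset.Iic i : Set ℕ) := by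
    intro f i x y h
    have : x i = y i := h i (by simp)
    simp only [this]
  have hmarkov : ∀ (f : Z → ℝ≥0∞) (i n : ℕ),
      ∫⁻ τ, f (τ i) * ∏ t ∈ Finset.range n, visitWeight G 2⁻¹ (τ (i + t)) ∂μ =
        ∫⁻ τ, f (τ i) * D^[n] (fun _ => 1) (τ i) ∂μ := by
    intro f i n
    simpa using M.lintegral_trajLaw_iterate π (visitWeight G 2⁻¹) (fun _ => 1) n i (hdep f i)
  -- From such a state `2 ^ (-visits)` has mean zero, hence vanishes almost surely, which forces
  -- infinitely many visits.
  have hnull : ∀ z, w z = 0 → ∀ i, ∀ᵐ τ ∂μ, τ i = z → τ ∈ satSet G := by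
    intro z hz i
    have hint : ∫⁻ τ, (if τ i = z then 1 else 0) *
        ⨅ n, ∏ t ∈ Finset.range n, visitWeight G 2⁻¹ (τ (i + t)) ∂μ = 0 := by
      refine nonpos_iff_eq_zero.1 (le_of_le_of_eq (le_iInf fun n => ?_) hz)
      calc _ ≤ ∫⁻ τ, (if τ i = z then 1 else 0) *
            ∏ t ∈ Finset.range n, visitWeight G 2⁻¹ (τ (i + t)) ∂μ := by
            exact lintegral_mono fun τ => mul_le_mul_right (iInf_le _ n) _
        _ = ∫⁻ τ, (if τ i = z then 1 else 0) * D^[n] (fun _ => 1) (τ i) ∂μ :=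
            hmarkov (fun x => if x = z then 1 else 0) i n
        _ ≤ ∫⁻ _, D^[n] (fun _ => 1) z ∂μ := by
            refine lintegral_mono fun τ => ?_
            dsimp only
            split_ifs with h <;> simp [h]
        _ = _ := by simp [μ]
    have hm : Measurable fun τ : ℕ → Z => (if τ i = z then (1 : ℝ≥0∞) else 0) *
        ⨅ n, ∏ t ∈ Finset.range n, visitWeight G 2⁻¹ (τ (i + t)) :=
      (hmeas (fun x => if x = z then 1 else 0) i).mul
        (Measurable.iInf fun n => measurable_prod_visitWeight _ i n)
    rw [lintegral_eq_zero_iff hm] at hint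
    filter_upwards [hint] with τ hτ hi
    by_contra hs
    have := iInf_prod_visitWeight_ne_zero hhalf (by simp) hs i
    simp [hi] at hτ
    exact this (by simpa using hτ)
  -- Bounding `w` by its iterate of order `n - i` gives every visit before `n` the common horizon
  -- `n`, where the pathwise bound applies.
  have hsum : ∑' i, ∫⁻ τ, visitReward G (τ i) * w (τ i) ∂μ ≤ 1 := by
    refine ENNReal.tsum_le_of_sum_range_le fun n => ?_
    calc _ ≤ ∑ i ∈ Finset.range n, ∫⁻ τ, visitReward G (τ i) * D^[n - i] (fun _ => 1) (τ i) ∂μ := by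
          exact Finset.sum_le_sum fun i _ => lintegral_mono fun τ =>
            mul_le_mul_right (iInf_le _ (n - i)) _
      _ = ∫⁻ τ, ∑ i ∈ Finset.range n, visitReward G (τ i) *
            ∏ t ∈ Finset.range (n - i), visitWeight G 2⁻¹ (τ (i + t)) ∂μ := by
          rw [lintegral_finsetSum]
          · exact Finset.sum_congr rfl fun i _ => (hmarkov _ i (n - i)).symm
          · exact fun i _ => (measurable_visitReward i).mul (measurable_prod_visitWeight _ i _)
      _ ≤ ∫⁻ _, 1 ∂μ := lintegral_mono fun τ => sum_visitReward_mul_prod_le_one τ n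
      _ = 1 := by simp [μ]
  -- Since `Z` is finite, the positive values of `w` are bounded below; the sum of their inverses
  -- serves as `C`.
  obtain ⟨C, hC, hCw⟩ : ∃ C : ℝ≥0∞, C ≠ ∞ ∧ ∀ z, w z ≠ 0 → 1 ≤ C * w z := by
    have := Fintype.ofFinite Z
    refine ⟨∑ z, if w z = 0 then 0 else (w z)⁻¹, ?_, fun z hz => ?_⟩
    · refine ENNReal.sum_ne_top.2 fun z _ => ?_
      split_ifs with h <;> simp [h]
    · have hwt : w z ≠ ∞ := ((iInf_le _ 0).trans_lt (by simp)).ne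
      calc (1 : ℝ≥0∞) = (w z)⁻¹ * w z := (ENNReal.inv_mul_cancel hz hwt).symm
        _ ≤ _ := by
          gcongr
          have := Finset.single_le_sum (f := fun z => if w z = 0 then 0 else (w z)⁻¹)
            (fun _ _ => zero_le) (Finset.mem_univ z)
          simpa [hz] using this
  have hterm : ∀ i, ∫⁻ τ in (satSet G)ᶜ, visitReward G (τ i) ∂μ ≤
      C * ∫⁻ τ, visitReward G (τ i) * w (τ i) ∂μ := by
    intro i
    have hm : Measurable fun τ : ℕ → Z => visitReward G (τ i) * w (τ i) :=
      (hmeas (visitReward G) i).mul (hmeas w i)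
    rw [← lintegral_const_mul _ hm]
    refine le_trans ?_ (setLIntegral_le_lintegral (satSet G)ᶜ _)
    refine lintegral_mono_ae ?_
    rw [ae_restrict_iff' measurableSet_satSet.compl]
    filter_upwards [ae_all_iff.2 fun z : {z // w z = 0} => hnull z z.2 i] with τ hτ hs
    have hwτ : w (τ i) ≠ 0 := fun h => hs (hτ ⟨τ i, h⟩ rfl)
    calc visitReward G (τ i) = visitReward G (τ i) * 1 := (mul_one _).symm
      _ ≤ visitReward G (τ i) * (C * w (τ i)) := by gcongr; exact hCw _ hwτ
      _ = _ := by ring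
  simp only [numVisits_eq_tsum]
  rw [lintegral_tsum fun i => (measurable_visitReward i).aemeasurable]
  refine ne_top_of_le_ne_top hC ((ENNReal.tsum_le_tsum hterm).trans ?_)
  rw [ENNReal.tsum_mul_left]
  exact mul_le_of_le_one_right' hsum

end MDP

/-! ### Satisfaction probabilities and values -/

namespace MDP

variable {Z : Type*} {Act : Z → Type*} [MeasurableSpace Z] [DiscreteMeasurableSpace Z] {G : Set Z}

theorem measure_satSet_le_value (M : MDP Z Act) {γ : ℝ} (hγ : γ ∈ Set.Ioo (0 : ℝ) 1)
    (π : Policy Act) :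
    M.trajLaw π (satSet G) ≤ ENNReal.ofReal (1 - γ) * M.value G γ π := by
  have hce : ENNReal.ofReal γ + ENNReal.ofReal (1 - γ) = 1 := by
    rw [← ENNReal.ofReal_add hγ.1.le (by linarith [hγ.2])]; simp
  have hc : ENNReal.ofReal γ < 1 := ENNReal.ofReal_lt_one.2 hγ.2
  rw [value_eq_lintegral M hγ.1.le, ← lintegral_const_mul' _ _ ENNReal.ofReal_ne_top,
    ← lintegral_indicator_one measurableSet_satSet]
  refine lintegral_mono fun τ => ?_
  by_cases hτ : τ ∈ satSet G
  · simpa [hτ] using one_le_mul_discountedVisits hce hc hτ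
  · simp [hτ]

theorem value_le_measure_satSet_add (M : MDP Z Act) {γ : ℝ} (hγ : γ ∈ Set.Ioo (0 : ℝ) 1)
    (π : Policy Act) :
    ENNReal.ofReal (1 - γ) * M.value G γ π ≤ M.trajLaw π (satSet G) +
      ENNReal.ofReal (1 - γ) * ∫⁻ τ in (satSet G)ᶜ, numVisits G τ ∂(M.trajLaw π) := by
  have hce : ENNReal.ofReal γ + ENNReal.ofReal (1 - γ) = 1 := by
    rw [← ENNReal.ofReal_add hγ.1.le (by linarith [hγ.2])]; simp
  have hc : ENNReal.ofReal γ < 1 := ENNReal.ofReal_lt_one.2 hγ.2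
  rw [value_eq_lintegral M hγ.1.le, ← lintegral_const_mul' _ _ ENNReal.ofReal_ne_top,
    ← lintegral_const_mul' _ _ ENNReal.ofReal_ne_top,
    ← lintegral_add_compl _ measurableSet_satSet]
  refine add_le_add ?_ ?_
  · calc _ ≤ ∫⁻ _ in satSet G, 1 ∂(M.trajLaw π) :=
          lintegral_mono fun τ => mul_discountedVisits_le_one hce τ
      _ = _ := by simp
  · exact lintegral_mono fun τ => mul_le_mul_right (discountedVisits_le_numVisits hc.le τ) _

/-- One deterministic policy is value-optimal for `γ` arbitrarily close to `1`. The error `(1 - γ)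
K` in the sandwich involves only this fixed policy, and `K` is finite, so it vanishes in the limit.
-/
theorem exists_detPolicy_satProb [Finite Z] [∀ z, Finite (Act z)] [∀ z, Nonempty (Act z)]
    (M : MDP Z Act) (G : Set Z) :
    ∃ d : DetPolicy Act, ∀ π : Policy Act, M.satProb G π ≤ M.satProb G d.toPolicy := by
  have hγ : ∀ᶠ γ : ℝ in nhdsWithin 1 (Set.Iio 1), γ ∈ Set.Ioo (0 : ℝ) 1 :=
    Ioo_mem_nhdsLT one_pos
  obtain ⟨d, hd⟩ := exists_frequently_of_finite (hγ.mono fun γ h => M.exists_detPolicy_value G h)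
  refine ⟨d, fun π => ENNReal.toReal_mono (measure_ne_top _ _) ?_⟩
  set K := ∫⁻ τ in (satSet G)ᶜ, numVisits G τ ∂(M.trajLaw d.toPolicy)
  have hlim : Tendsto (fun γ : ℝ => M.trajLaw d.toPolicy (satSet G) + ENNReal.ofReal (1 - γ) * K)
      (nhdsWithin 1 (Set.Iio 1)) (nhds (M.trajLaw d.toPolicy (satSet G) +
        ENNReal.ofReal (1 - 1) * K)) := by
    refine tendsto_const_nhds.add (ENNReal.Tendsto.mul_const ?_
      (Or.inr (M.setLIntegral_numVisits_ne_top G d.toPolicy)))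
    exact ENNReal.tendsto_ofReal ((tendsto_const_nhds.sub tendsto_id).mono_left nhdsWithin_le_nhds)
  rw [sub_self, ENNReal.ofReal_zero, zero_mul, add_zero] at hlim
  refine ge_of_tendsto_of_frequently hlim ((hd.and_eventually hγ).mono ?_)
  rintro γ ⟨h, hγ⟩
  exact (M.measure_satSet_le_value hγ π).trans ((mul_le_mul_right (h π) _).trans
    (M.value_le_measure_satSet_add hγ d.toPolicy))

/-- Conditioning divides by a probability, which is at most `1`. -/
theorem setLIntegral_numVisits_le_expVisits (M : MDP Z Act) (π : Policy Act) :
    ∫⁻ τ in (satSet G)ᶜ, numVisits G τ ∂(M.trajLaw π) ≤ M.expVisits G π := by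
  rw [expVisits, ProbabilityTheory.cond, lintegral_smul_measure, smul_eq_mul]
  exact le_mul_of_one_le_left' (ENNReal.one_le_inv.2 prob_le_one)

theorem expVisits_ne_top [Finite Z] (M : MDP Z Act) (π : Policy Act) :
    M.expVisits G π ≠ ∞ := by
  rw [expVisits, ProbabilityTheory.cond]
  by_cases h : M.trajLaw π (satSet G)ᶜ = 0
  · simp [Measure.restrict_eq_zero.2 h]
  · rw [lintegral_smul_measure, smul_eq_mul]
    exact ENNReal.mul_ne_top (ENNReal.inv_ne_top.2 h) (M.setLIntegral_numVisits_ne_top G π)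

/-- A policy whose value is at least that of `π` satisfies the Büchi condition with almost the
probability that `π` does. -/
theorem satProb_sub_le (M : MDP Z Act) {γ : ℝ} (hγ : γ ∈ Set.Ioo (0 : ℝ) 1) {π π' : Policy Act}
    (h : M.value G γ π ≤ M.value G γ π') {m : ℝ≥0} (hm : M.expVisits G π' ≤ m) :
    M.satProb G π - M.satProb G π' ≤ m * Real.log (1 / γ) := by
  have h1 : M.trajLaw π (satSet G) ≤ M.trajLaw π' (satSet G) + ENNReal.ofReal (1 - γ) * m :=
    (M.measure_satSet_le_value hγ π).trans ((mul_le_mul_right h _).trans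
      ((M.value_le_measure_satSet_add hγ π').trans (add_le_add le_rfl
        (mul_le_mul_right ((M.setLIntegral_numVisits_le_expVisits π').trans hm) _))))
  have h2 := ENNReal.toReal_mono (ENNReal.add_ne_top.2 ⟨measure_ne_top _ _,
    ENNReal.mul_ne_top ENNReal.ofReal_ne_top ENNReal.coe_ne_top⟩) h1
  rw [ENNReal.toReal_add (measure_ne_top _ _)
    (ENNReal.mul_ne_top ENNReal.ofReal_ne_top ENNReal.coe_ne_top), ENNReal.toReal_mul,
    ENNReal.toReal_ofReal (by linarith [hγ.2]), ENNReal.coe_toReal] at h2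
  have hlog : 1 - γ ≤ Real.log (1 / γ) := by
    rw [one_div, Real.log_inv]
    linarith [Real.log_le_sub_one_of_pos hγ.1]
  have h3 : (1 - γ) * m ≤ Real.log (1 / γ) * m := mul_le_mul_of_nonneg_right hlog m.2
  simp only [satProb, Measure.real]
  linarith

end MDP

theorem mainTheorem3 {S A AP Q : Type*} {J : Q → Type*}
    [Finite S] [MeasurableSpace S] [MeasurableSingletonClass S]
    [Finite A] [Nonempty A]
    [Finite Q] [MeasurableSpace Q] [MeasurableSingletonClass Q]
    [∀ b, Finite (J b)]
    (M : LabelledMDP S A AP) (B : LDBA AP Q J) :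
    -- the product has finitely many states, actions and deterministic policies
    Finite (S × Q) ∧ Finite (A ⊕ (Σ b, J b)) ∧ Finite (DetPolicy (ProductAct S A J)) ∧
    -- some deterministic policy maximizes the satisfaction probability among all policies
    (∃ d : DetPolicy (ProductAct S A J), ∀ π : Policy (ProductAct S A J),
      (productMDP M B).satProb (goodStates S B) π ≤
        (productMDP M B).satProb (goodStates S B) d.toPolicy) ∧
    -- some deterministic policy maximizes the eventually discounted value among all policies
    (∀ γ ∈ Set.Ioo (0 : ℝ) 1,
      ∃ d : DetPolicy (ProductAct S A J), ∀ π : Policy (ProductAct S A J),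
        (productMDP M B).value (goodStates S B) γ π ≤
          (productMDP M B).value (goodStates S B) γ d.toPolicy) ∧
    -- the supremum of `O_π` over deterministic policies is finite and attained, and bounds the gap
    ∃ m : ℝ≥0,
      IsGreatest (Set.range fun d : DetPolicy (ProductAct S A J) =>
        (productMDP M B).expVisits (goodStates S B) d.toPolicy) (m : ℝ≥0∞) ∧
      ∀ γ ∈ Set.Ioo (0 : ℝ) 1, ∀ dγ : DetPolicy (ProductAct S A J),
        (∀ d : DetPolicy (ProductAct S A J),
          (productMDP M B).value (goodStates S B) γ d.toPolicy ≤
            (productMDP M B).value (goodStates S B) γ dγ.toPolicy) →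
        (⨆ π : Policy (ProductAct S A J), (productMDP M B).satProb (goodStates S B) π) -
            (productMDP M B).satProb (goodStates S B) dγ.toPolicy ≤
          2 * m * Real.log (1 / γ) := by
  have : ∀ z : S × Q, Finite (ProductAct S A J z) := fun z => inferInstance
  have : ∀ z : S × Q, Nonempty (ProductAct S A J z) := fun z => inferInstance
  obtain ⟨d₀, hd₀⟩ := (productMDP M B).exists_detPolicy_satProb (goodStates S B)
  refine ⟨inferInstance, inferInstance, inferInstance, ⟨d₀, hd₀⟩,
    fun γ hγ => (productMDP M B).exists_detPolicy_value _ hγ, ?_⟩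
  have : Nonempty (DetPolicy (ProductAct S A J)) := ⟨d₀⟩
  obtain ⟨d₁, hd₁⟩ := Finite.exists_max fun d : DetPolicy (ProductAct S A J) =>
    (productMDP M B).expVisits (goodStates S B) d.toPolicy
  obtain ⟨m, hcoe⟩ : ∃ m : ℝ≥0, (m : ℝ≥0∞) =
      (productMDP M B).expVisits (goodStates S B) d₁.toPolicy :=
    ⟨_, ENNReal.coe_toNNReal ((productMDP M B).expVisits_ne_top d₁.toPolicy)⟩
  refine ⟨m, ⟨⟨d₁, hcoe.symm⟩, Set.forall_mem_range.2 fun d => (hd₁ d).trans hcoe.ge⟩, fun γ hγ dγ hdγ => ?_⟩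
  have hm : (productMDP M B).expVisits (goodStates S B) dγ.toPolicy ≤ m :=
    (hd₁ dγ).trans hcoe.ge
  have hpol : Nonempty (Policy (ProductAct S A J)) := ⟨d₀.toPolicy⟩
  have hsup : (⨆ π : Policy (ProductAct S A J),
      (productMDP M B).satProb (goodStates S B) π) ≤
      (productMDP M B).satProb (goodStates S B) d₀.toPolicy := ciSup_le hd₀
  -- As the satisfaction-optimal `d₀` is itself deterministic, maximality of `dγ` among
  -- deterministic policies suffices. The resulting bound lacks the factor `2`, which is slack since
  -- `m * log (1/γ) ≥ 0`.
  have hgap := (productMDP M B).satProb_sub_le hγ (hdγ d₀) hm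
  have hlog : 0 ≤ Real.log (1 / γ) := Real.log_nonneg (one_le_one_div hγ.1 hγ.2.le)
  have hnn : 0 ≤ m * Real.log (1 / γ) := mul_nonneg m.2 hlog
  linarith
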